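/- For $\alpha>0$ and $x\in\mathbb{R}$ let $$\mathcal{L}_\alpha(x)=\sum_{n\ge 0}\frac{x^n}{(n!)^\alpha}$$ be the Le Roy function (the series converges for every real $x$), and for $\alpha=0$ let $\mathcal{L}_0(x)=\frac{1}{1-x}$ if $x<1$ and $\mathcal{L}_0(x)=+\infty$ if $x\ge 1$. Then for every $x\in\mathbb{R}$ the map $\alpha\mapsto\mathcal{L}_\alpha(x)$ is non-increasing on $[0,1]$, that is, $\mathcal{L}_\beta(x)\le\mathcal{L}_\alpha(x)$ whenever $0\le\alpha\le\beta\le 1$. -/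

import Mathlib

open scoped Nat

/-- The Le Roy function `L_α(x)` at a real point, as an extended real number.
For `α > 0` it is the (everywhere convergent) series `∑ xⁿ / (n!)^α`.
For `α = 0` it is `1 / (1 - x)` for `x < 1` (the sum of the geometric series for `|x| < 1`, continued
to `x ≤ -1`) and `+∞` for `x ≥ 1`, where the series of nonnegative terms diverges; equivalently,
`L_0(x) = E[exp (x L)]` with `L` a standard exponential random variable. -/
noncomputable def leRoy (α x : ℝ) : EReal :=
  if α = 0 then
    if x < 1 then ((1 / (1 - x) : ℝ) : EReal) else ⊤
  else ((∑' n : ℕ, x ^ n / (n ! : ℝ) ^ α : ℝ) : EReal)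

/-- For `α > 0` the series defining `L_α(x)` converges for every real `x`. -/
theorem summable_leRoy {α : ℝ} (hα : 0 < α) (x : ℝ) :
    Summable fun n : ℕ => x ^ n / (n ! : ℝ) ^ α := by
  rcases eq_or_ne x 0 with rfl | hx
  · refine summable_of_ne_finset_zero (s := {0}) fun n hn => ?_
    have : n ≠ 0 := by simpa using hn
    simp [this]
  have hf : ∀ n : ℕ, (0 : ℝ) < (n ! : ℝ) ^ α := fun n =>
    Real.rpow_pos_of_pos (by exact_mod_cast n.factorial_pos) _
  refine summable_of_ratio_test_tendsto_lt_one (l := 0) one_pos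
    (Filter.Eventually.of_forall fun n => div_ne_zero (pow_ne_zero _ hx) (hf n).ne') ?_
  have key : ∀ n : ℕ, ‖x ^ (n + 1) / ((n + 1) ! : ℝ) ^ α‖ / ‖x ^ n / (n ! : ℝ) ^ α‖
      = |x| / ((n + 1 : ℕ) : ℝ) ^ α := by
    intro n
    have h1 : (0 : ℝ) < ((n + 1 : ℕ) : ℝ) ^ α := Real.rpow_pos_of_pos (by positivity) _
    have h2 : |x| ≠ 0 := abs_ne_zero.mpr hx
    have h3 := (hf n).ne'
    have h4 := h1.ne'
    rw [Nat.factorial_succ, Nat.cast_mul, Real.mul_rpow (by positivity) (by positivity)]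
    rw [norm_div, norm_div, norm_mul, Real.norm_of_nonneg h1.le, Real.norm_of_nonneg (hf n).le,
      norm_pow, norm_pow, Real.norm_eq_abs, pow_succ]
    field_simp
  simp_rw [key]
  exact Filter.Tendsto.const_div_atTop ((tendsto_rpow_atTop hα).comp
    (tendsto_natCast_atTop_atTop.comp (Filter.tendsto_add_atTop_nat 1))) _

open MeasureTheory ProbabilityTheory Filter Topology

/-! With `t = 1 - α` the series is `∑ xⁿ/n! · (n!)^t`. The logarithm of a standard exponential
variable is infinitely divisible, so `(n!)^t` is the moment sequence of a multiplicative Lévy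
process at time `t`. Its mean is `(1!)^t = 1`, so it is a martingale, and convexity of `y ↦ exp (x
y)` makes the series non-decreasing in `t` (`IsMomentSeq.tsum_le_tsum_mul`).

To keep all variables bounded, `n!` is replaced by the moments `scaledBetaMoment m n ≤ n!` of a beta
variable of mean `1`. Their powers are again moments, by a factorization into exponentials of gamma
variables (`IsMomentSeq.gamma`), and `m → ∞` recovers `n!`. The endpoint `α = 0` needs a separate
bound by `1 / (1 - x)`. -/

/-- `c` is the moment sequence of a probability measure carried by `[0, C]`. -/
def IsMomentSeq (C : ℝ) (c : ℕ → ℝ) : Prop :=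
  ∃ μ : Measure ℝ, IsProbabilityMeasure μ ∧ (∀ᵐ y ∂μ, y ∈ Set.Icc 0 C) ∧
    ∀ n, ∫ y, y ^ n ∂μ = c n

/-- The exponential generating function of the moments of a bounded random variable is its
moment generating function. -/
theorem hasSum_moments_exp {Ω : Type*} [MeasurableSpace Ω] {P : Measure Ω} [IsFiniteMeasure P]
    {f : Ω → ℝ} (hf : Measurable f) {C : ℝ} (hC : ∀ᵐ ω ∂P, |f ω| ≤ C) (x : ℝ) :
    HasSum (fun n : ℕ => x ^ n / n ! * ∫ ω, f ω ^ n ∂P) (∫ ω, Real.exp (x * f ω) ∂P) := by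
  simp_rw [← integral_const_mul]
  refine hasSum_integral_of_dominated_convergence (fun n _ => (|x| * C) ^ n / n !)
    (fun n => (by fun_prop : Measurable fun ω => x ^ n / (n ! : ℝ) * f ω ^ n).aestronglyMeasurable)
    (fun n => ?_) (ae_of_all _ fun _ => Real.summable_pow_div_factorial _)
    (integrable_const _) (ae_of_all _ fun ω => ?_)
  · filter_upwards [hC] with ω hω
    rw [norm_mul, norm_div, norm_pow, norm_pow, Real.norm_natCast, Real.norm_eq_abs,
      Real.norm_eq_abs, mul_pow, mul_div_right_comm]
    gcongr
  · rw [Real.exp_eq_exp_ℝ]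
    simpa only [mul_pow, mul_div_right_comm] using
      NormedSpace.expSeries_div_hasSum_exp (x * f ω)

theorem ae_prod_of_ae {μ ν : Measure ℝ} [SFinite μ] [SFinite ν] {p q : ℝ → Prop}
    (hp : ∀ᵐ y ∂μ, p y) (hq : ∀ᵐ z ∂ν, q z) : ∀ᵐ w ∂μ.prod ν, p w.1 ∧ q w.2 :=
  (Measure.quasiMeasurePreserving_fst.ae hp).and (Measure.quasiMeasurePreserving_snd.ae hq)

theorem integral_prod_mul_pow {μ ν : Measure ℝ} [SFinite μ] [SFinite ν] (n : ℕ) :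
    ∫ w : ℝ × ℝ, (w.1 * w.2) ^ n ∂μ.prod ν = (∫ y, y ^ n ∂μ) * ∫ z, z ^ n ∂ν := by
  simp_rw [mul_pow]
  exact integral_prod_mul (fun y : ℝ => y ^ n) (fun z : ℝ => z ^ n)

/-! ### Moment sequences of bounded nonnegative variables -/

namespace IsMomentSeq

variable {C D : ℝ} {c d : ℕ → ℝ}

theorem one : IsMomentSeq 1 fun _ => 1 :=
  ⟨Measure.dirac 1, inferInstance, by rw [ae_dirac_eq]; simp, by simp⟩

theorem const_pow (hC : 0 ≤ C) : IsMomentSeq C fun n => C ^ n :=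
  ⟨Measure.dirac C, inferInstance, by rw [ae_dirac_eq]; simpa using hC, by simp⟩

/-- The product of independent variables has these moments. -/
theorem mul (hc : IsMomentSeq C c) (hd : IsMomentSeq D d) :
    IsMomentSeq (C * D) fun n => c n * d n := by
  obtain ⟨μ, hμ, hμC, hμc⟩ := hc
  obtain ⟨ν, hν, hνD, hνd⟩ := hd
  have hm : Measurable fun w : ℝ × ℝ => w.1 * w.2 := by fun_prop
  refine ⟨(μ.prod ν).map fun w => w.1 * w.2, Measure.isProbabilityMeasure_map hm.aemeasurable,
    ?_, fun n => ?_⟩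
  · refine (ae_map_iff hm.aemeasurable measurableSet_Icc).2 ?_
    filter_upwards [ae_prod_of_ae hμC hνD] with w ⟨h1, h2⟩
    exact ⟨mul_nonneg h1.1 h2.1, mul_le_mul h1.2 h2.2 h2.1 (h1.1.trans h1.2)⟩
  · rw [integral_map hm.aemeasurable (by fun_prop)]
    simp only [integral_prod_mul_pow, hμc, hνd]

theorem prod {c : ℕ → ℕ → ℝ} (h : ∀ i, IsMomentSeq 1 (c i)) (m : ℕ) :
    IsMomentSeq 1 fun n => ∏ i ∈ Finset.range m, c i n := by
  induction m with
  | zero => simpa using one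
  | succ m ih => simpa [Finset.prod_range_succ] using ih.mul (h m)

/-- Moments of `exp (-G)` for a gamma distributed variable `G`. -/
theorem gamma {t r : ℝ} (ht : 0 ≤ t) (hr : 0 < r) :
    IsMomentSeq 1 fun n => (r / (r + n)) ^ t := by
  rcases ht.eq_or_lt with rfl | ht
  · simpa using one
  have hP := isProbabilityMeasure_gammaMeasure ht hr
  have hm : Measurable fun y : ℝ => Real.exp (-y) := by fun_prop
  have hd : Measurable (gammaPDF t r) := (measurable_gammaPDFReal t r).ennreal_ofReal
  refine ⟨(gammaMeasure t r).map fun y => Real.exp (-y),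
    Measure.isProbabilityMeasure_map hm.aemeasurable, ?_, fun n => ?_⟩
  · refine (ae_map_iff hm.aemeasurable measurableSet_Icc).2 ?_
    rw [gammaMeasure, ae_withDensity_iff hd]
    refine ae_of_all _ fun y hy => ⟨(Real.exp_pos _).le, Real.exp_le_one_iff.2 ?_⟩
    by_contra! h
    exact hy (gammaPDF_of_neg (by linarith))
  · have hrn : 0 < r + n := by positivity
    rw [integral_map hm.aemeasurable (by fun_prop), gammaMeasure,
      integral_withDensity_eq_integral_toReal_smul hd (ae_of_all _ fun _ => ENNReal.ofReal_lt_top)]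
    have key : ∀ y : ℝ, (gammaPDF t r y).toReal • Real.exp (-y) ^ n =
        (Set.Ici (0 : ℝ)).indicator (fun y =>
          r ^ t / Real.Gamma t * (y ^ (t - 1) * Real.exp (-((r + n) * y)))) y := by
      intro y
      rw [gammaPDF, ENNReal.toReal_ofReal (gammaPDFReal_nonneg ht hr y), gammaPDFReal,
        Set.indicator_apply]
      simp only [Set.mem_Ici, smul_eq_mul]
      split_ifs
      · rw [← Real.exp_nat_mul, mul_assoc, mul_assoc, ← Real.exp_add]
        ring_nf
      · simp
    simp_rw [key]
    rw [integral_indicator measurableSet_Ici, integral_Ici_eq_integral_Ioi, integral_const_mul,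
      Real.integral_rpow_mul_exp_neg_mul_Ioi ht hrn, Real.div_rpow hr.le hrn.le,
      Real.div_rpow zero_le_one hrn.le, Real.one_rpow]
    have := (Real.Gamma_pos_of_pos ht).ne'
    field_simp

theorem summable (hc : IsMomentSeq C c) (x : ℝ) : Summable fun n => x ^ n / n ! * c n := by
  obtain ⟨μ, hμ, hμC, hμc⟩ := hc
  simp_rw [← hμc]
  refine (hasSum_moments_exp measurable_id (C := C) ?_ x).summable
  filter_upwards [hμC] with y hy
  simpa [abs_of_nonneg hy.1] using hy.2

/-- Multiplying by an independent factor of mean `1` increases the moment generating function. -/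
theorem tsum_le_tsum_mul (hc : IsMomentSeq C c) (hd : IsMomentSeq D d) (hd1 : d 1 = 1) (x : ℝ) :
    ∑' n, x ^ n / n ! * c n ≤ ∑' n, x ^ n / n ! * (c n * d n) := by
  obtain ⟨μ, hμ, hμC, hμc⟩ := hc
  obtain ⟨ν, hν, hνD, hνd⟩ := hd
  have hB := ae_prod_of_ae hμC hνD
  have h1 := hasSum_moments_exp (P := μ) measurable_id (C := C) (by
    filter_upwards [hμC] with y hy
    simpa [abs_of_nonneg hy.1] using hy.2) x
  have h2 := hasSum_moments_exp (P := μ.prod ν) (f := fun w => w.1 * w.2) (by fun_prop)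
    (C := C * D) (by
    filter_upwards [hB] with w ⟨hw1, hw2⟩
    rw [abs_of_nonneg (mul_nonneg hw1.1 hw2.1)]
    exact mul_le_mul hw1.2 hw2.2 hw2.1 (hw1.1.trans hw1.2)) x
  simp_rw [integral_prod_mul_pow, hμc, hνd] at h2
  simp only [id, hμc] at h1
  rw [h1.tsum_eq, h2.tsum_eq]
  have ie : Integrable (fun y => Real.exp (x * y)) μ := by
    refine .of_bound (by fun_prop) (Real.exp (|x| * C)) ?_
    filter_upwards [hμC] with y hy
    rw [Real.norm_eq_abs, Real.abs_exp]
    refine Real.exp_le_exp.2 ?_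
    calc x * y ≤ |x| * y := mul_le_mul_of_nonneg_right (le_abs_self x) hy.1
      _ ≤ |x| * C := mul_le_mul_of_nonneg_left hy.2 (abs_nonneg x)
  have iye : Integrable (fun y => Real.exp (x * y) * (x * y)) μ := by
    refine ie.mul_bdd (c := |x| * C) (by fun_prop) ?_
    filter_upwards [hμC] with y hy
    rw [Real.norm_eq_abs, abs_mul, abs_of_nonneg hy.1]
    exact mul_le_mul_of_nonneg_left hy.2 (abs_nonneg x)
  have iz : Integrable (fun z : ℝ => z) ν := by
    refine .of_bound (by fun_prop) D ?_
    filter_upwards [hνD] with y hy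
    rw [Real.norm_eq_abs, abs_of_nonneg hy.1]
    exact hy.2
  have iz1 : Integrable (fun z : ℝ => z - 1) ν := iz.sub (integrable_const _)
  have i2 : Integrable (fun w : ℝ × ℝ => Real.exp (x * (w.1 * w.2))) (μ.prod ν) := by
    refine .of_bound (by fun_prop) (Real.exp (|x| * (C * D))) ?_
    filter_upwards [hB] with w ⟨hw1, hw2⟩
    rw [Real.norm_eq_abs, Real.abs_exp]
    refine Real.exp_le_exp.2 ?_
    calc x * (w.1 * w.2) ≤ |x| * (w.1 * w.2) :=
          mul_le_mul_of_nonneg_right (le_abs_self x) (mul_nonneg hw1.1 hw2.1)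
      _ ≤ |x| * (C * D) := mul_le_mul_of_nonneg_left
          (mul_le_mul hw1.2 hw2.2 hw2.1 (hw1.1.trans hw1.2)) (abs_nonneg x)
  have hz : ∫ z, (z - 1) ∂ν = 0 := by
    rw [integral_sub iz (integrable_const _)]
    have := hνd 1
    simp only [pow_one] at this
    simp [this, hd1]
  have ia := ie.mul_prod (integrable_const (1 : ℝ) (μ := ν))
  have ib := iye.mul_prod iz1
  -- Jensen by the tangent at `z = 1`: `exp (xyz) ≥ exp (xy) (1 + xy (z - 1))`. The linear term
  -- integrates to `0` by independence and `hz`.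
  calc ∫ y, Real.exp (x * y) ∂μ
      = ∫ w, Real.exp (x * w.1) * 1 + Real.exp (x * w.1) * (x * w.1) * (w.2 - 1) ∂μ.prod ν := by
        rw [integral_add ia ib, integral_prod_mul (fun y => Real.exp (x * y)) (fun _ => (1 : ℝ)),
          integral_prod_mul (fun y => Real.exp (x * y) * (x * y)) (fun z => z - 1), hz]
        simp
    _ ≤ ∫ w, Real.exp (x * (w.1 * w.2)) ∂μ.prod ν := by
        refine integral_mono (ia.add ib) i2 fun w => ?_
        have h : Real.exp (x * (w.1 * w.2)) =
            Real.exp (x * w.1) * Real.exp (x * w.1 * (w.2 - 1)) := by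
          rw [← Real.exp_add]; ring_nf
        have := mul_le_mul_of_nonneg_left (Real.add_one_le_exp (x * w.1 * (w.2 - 1)))
          (Real.exp_pos (x * w.1)).le
        simp only [h]
        linarith

/-- Multiplying by an independent factor in `[0, 1]` increases the moment generating function
at nonpositive points. -/
theorem tsum_le_tsum_mul_of_nonpos (hc : IsMomentSeq C c) (hd : IsMomentSeq 1 d) {x : ℝ}
    (hx : x ≤ 0) : ∑' n, x ^ n / n ! * c n ≤ ∑' n, x ^ n / n ! * (c n * d n) := by
  obtain ⟨μ, hμ, hμC, hμc⟩ := hc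
  obtain ⟨ν, hν, hνD, hνd⟩ := hd
  have hB := ae_prod_of_ae hμC hνD
  have h1 := hasSum_moments_exp (P := μ.prod ν) (f := fun w => w.1) (by fun_prop) (C := C) (by
    filter_upwards [hB] with w ⟨hw, _⟩
    simpa [abs_of_nonneg hw.1] using hw.2) x
  have h2 := hasSum_moments_exp (P := μ.prod ν) (f := fun w => w.1 * w.2) (by fun_prop)
    (C := C) (by
    filter_upwards [hB] with w ⟨hw1, hw2⟩
    rw [abs_of_nonneg (mul_nonneg hw1.1 hw2.1)]
    exact (mul_le_of_le_one_right hw1.1 hw2.2).trans hw1.2) x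
  have h3 (n : ℕ) : ∫ w : ℝ × ℝ, w.1 ^ n ∂μ.prod ν = c n := by
    have := integral_prod_mul (μ := μ) (ν := ν) (fun y : ℝ => y ^ n) (fun _ => (1 : ℝ))
    simpa [hμc] using this
  simp_rw [integral_prod_mul_pow, hμc, hνd] at h2
  simp_rw [h3] at h1
  rw [h1.tsum_eq, h2.tsum_eq]
  refine integral_mono_ae ?_ ?_ ?_
  · refine .of_bound (by fun_prop) 1 ?_
    filter_upwards [hB] with w ⟨hw1, hw2⟩
    rw [Real.norm_eq_abs, Real.abs_exp]
    exact Real.exp_le_one_iff.2 (mul_nonpos_of_nonpos_of_nonneg hx hw1.1)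
  · refine .of_bound (by fun_prop) 1 ?_
    filter_upwards [hB] with w ⟨hw1, hw2⟩
    rw [Real.norm_eq_abs, Real.abs_exp]
    exact Real.exp_le_one_iff.2 (mul_nonpos_of_nonpos_of_nonneg hx (mul_nonneg hw1.1 hw2.1))
  · filter_upwards [hB] with w ⟨hw1, hw2⟩
    exact Real.exp_le_exp.2
      (mul_le_mul_of_nonpos_left (mul_le_of_le_one_right hw1.1 hw2.2) hx)

end IsMomentSeq

/-! ### Beta moments and their rescaling -/

/-- The moments `m! n! / (m + n)!` of the beta distribution with parameters `1` and `m`, as a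
product. -/
noncomputable def betaMoment (m n : ℕ) : ℝ :=
  ∏ i ∈ Finset.range m, ((i + 1 : ℝ) / (i + 1 + n))

theorem betaMoment_pos (m n : ℕ) : 0 < betaMoment m n :=
  Finset.prod_pos fun i _ => by positivity

theorem betaMoment_succ_left (m n : ℕ) :
    betaMoment (m + 1) n = betaMoment m n * ((m + 1 : ℝ) / (m + 1 + n)) := by
  rw [betaMoment, Finset.prod_range_succ, betaMoment]

theorem betaMoment_succ_right (m n : ℕ) :
    betaMoment m (n + 1) = betaMoment m n * ((n + 1 : ℝ) / (m + 1 + n)) := by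
  induction m with
  | zero =>
    have : (0 : ℝ) < 1 + n := by positivity
    simp [betaMoment]
    rw [add_comm, div_self this.ne']
  | succ m ih =>
    rw [betaMoment_succ_left, ih, betaMoment_succ_left]
    push_cast
    have h1 : (0 : ℝ) < m + 1 + n := by positivity
    have h2 : (0 : ℝ) < m + 1 + (n + 1) := by positivity
    have h3 : (0 : ℝ) < m + 1 + 1 + n := by positivity
    field_simp
    ring

theorem isMomentSeq_betaMoment_rpow {t : ℝ} (ht : 0 ≤ t) (m : ℕ) :
    IsMomentSeq 1 fun n => betaMoment m n ^ t := by
  have h := IsMomentSeq.prod (c := fun i n => ((i + 1 : ℝ) / (i + 1 + n)) ^ t)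
    (fun i => IsMomentSeq.gamma ht (by positivity)) m
  convert h using 2 with n
  rw [betaMoment, Real.finsetProd_rpow]
  exact fun i _ => by positivity

/-- The beta moments rescaled to mean `1`; as `m → ∞` they tend to `n!`. -/
noncomputable def scaledBetaMoment (m n : ℕ) : ℝ := (m + 1 : ℝ) ^ n * betaMoment m n

theorem scaledBetaMoment_pos (m n : ℕ) : 0 < scaledBetaMoment m n :=
  mul_pos (by positivity) (betaMoment_pos m n)

theorem scaledBetaMoment_zero (m : ℕ) : scaledBetaMoment m 0 = 1 := by
  rw [scaledBetaMoment, betaMoment, pow_zero, one_mul]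
  refine Finset.prod_eq_one fun i _ => ?_
  have : (0 : ℝ) < i + 1 := by positivity
  simp [this.ne']

theorem scaledBetaMoment_succ (m n : ℕ) :
    scaledBetaMoment m (n + 1) = (n + 1) * scaledBetaMoment m n * ((m + 1 : ℝ) / (m + 1 + n)) := by
  rw [scaledBetaMoment, betaMoment_succ_right, scaledBetaMoment]
  ring

theorem scaledBetaMoment_one (m : ℕ) : scaledBetaMoment m 1 = 1 := by
  have : (m + 1 : ℝ) ≠ 0 := by positivity
  simpa [scaledBetaMoment_zero, this] using scaledBetaMoment_succ m 0

theorem scaledBetaMoment_le_factorial (m n : ℕ) : scaledBetaMoment m n ≤ n ! := by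
  induction n with
  | zero => simp [scaledBetaMoment_zero]
  | succ n ih =>
    rw [scaledBetaMoment_succ, Nat.factorial_succ]
    push_cast
    have h : (m + 1 : ℝ) / (m + 1 + n) ≤ 1 := div_le_one_of_le₀ (by simp) (by positivity)
    have := (scaledBetaMoment_pos m n).le
    calc _ ≤ (n + 1) * scaledBetaMoment m n * 1 := by gcongr
      _ ≤ _ := by rw [mul_one]; gcongr

theorem tendsto_scaledBetaMoment (n : ℕ) :
    Tendsto (fun m => scaledBetaMoment m n) atTop (𝓝 (n ! : ℝ)) := by
  induction n with
  | zero => simp [scaledBetaMoment_zero]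
  | succ n ih =>
    simp_rw [scaledBetaMoment_succ, Nat.factorial_succ]
    push_cast
    have h : Tendsto (fun m : ℕ => (m + 1 : ℝ) / (m + 1 + n)) atTop (𝓝 1) := by
      have := (tendsto_natCast_div_add_atTop (n : ℝ)).comp (tendsto_add_atTop_nat 1)
      simpa [Function.comp_def] using this
    simpa using (ih.const_mul ((n : ℝ) + 1)).mul h

/-- The scale `(m + 1)^n` becomes, after the power `t`, the moments of the constant `(m + 1)^t`. -/
theorem isMomentSeq_scaledBetaMoment_rpow {t : ℝ} (ht : 0 ≤ t) (m : ℕ) :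
    ∃ C, IsMomentSeq C fun n => scaledBetaMoment m n ^ t := by
  have h := (IsMomentSeq.const_pow (C := (m + 1 : ℝ) ^ t) (by positivity)).mul
    (isMomentSeq_betaMoment_rpow ht m)
  refine ⟨(m + 1 : ℝ) ^ t * 1, ?_⟩
  convert h using 2 with n
  rw [scaledBetaMoment, Real.mul_rpow (by positivity) (betaMoment_pos m n).le,
    ← Real.rpow_natCast, ← Real.rpow_natCast, ← Real.rpow_mul (by positivity),
    ← Real.rpow_mul (by positivity), mul_comm t]

/-- The power `t` is the power `s` times an independent factor with exponent `t - s`, whose mean is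
`1`. -/
theorem tsum_scaledBetaMoment_rpow_mono {s t : ℝ} (hs : 0 ≤ s) (hst : s ≤ t) (m : ℕ) (x : ℝ) :
    ∑' n, x ^ n / n ! * scaledBetaMoment m n ^ s ≤
      ∑' n, x ^ n / n ! * scaledBetaMoment m n ^ t := by
  obtain ⟨_, hC⟩ := isMomentSeq_scaledBetaMoment_rpow hs m
  obtain ⟨_, hD⟩ := isMomentSeq_scaledBetaMoment_rpow (sub_nonneg.2 hst) m
  have h := hC.tsum_le_tsum_mul hD (by simp [scaledBetaMoment_one]) x
  simpa [← Real.rpow_add (scaledBetaMoment_pos m _)] using h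

/-! ### Passage to the limit for positive `α` -/

theorem pow_div_factorial_mul_rpow (α x : ℝ) (n : ℕ) :
    x ^ n / n ! * (n ! : ℝ) ^ (1 - α) = x ^ n / (n ! : ℝ) ^ α := by
  have h : (0 : ℝ) < n ! := by positivity
  rw [Real.rpow_sub h, Real.rpow_one]
  field_simp

theorem tendsto_tsum_scaledBetaMoment {α : ℝ} (h0 : 0 < α) (h1 : α ≤ 1) (x : ℝ) :
    Tendsto (fun m => ∑' n, x ^ n / n ! * scaledBetaMoment m n ^ (1 - α)) atTop
      (𝓝 (∑' n, x ^ n / (n ! : ℝ) ^ α)) := by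
  -- The bound `scaledBetaMoment m n ≤ n!` gives the majorant `|x|^n / (n!)^α`, summable because `α
  -- > 0`.
  refine tendsto_tsum_of_dominated_convergence (summable_leRoy h0 |x|) (fun n => ?_)
    (Eventually.of_forall fun m n => ?_)
  · rw [← pow_div_factorial_mul_rpow]
    exact ((tendsto_scaledBetaMoment n).rpow_const (.inr (by linarith))).const_mul _
  · have hp := (scaledBetaMoment_pos m n).le
    rw [← pow_div_factorial_mul_rpow, norm_mul, norm_div, norm_pow, Real.norm_eq_abs,
      Real.norm_natCast, Real.norm_of_nonneg (Real.rpow_nonneg hp _)]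
    exact mul_le_mul_of_nonneg_left (Real.rpow_le_rpow hp (scaledBetaMoment_le_factorial m n)
      (by linarith)) (by positivity)

theorem tsum_leRoy_antitone {α β : ℝ} (hα : 0 < α) (hαβ : α ≤ β) (hβ : β ≤ 1) (x : ℝ) :
    ∑' n : ℕ, x ^ n / (n ! : ℝ) ^ β ≤ ∑' n : ℕ, x ^ n / (n ! : ℝ) ^ α :=
  le_of_tendsto_of_tendsto' (tendsto_tsum_scaledBetaMoment (hα.trans_le hαβ) hβ x)
    (tendsto_tsum_scaledBetaMoment hα (hαβ.trans hβ) x) fun m =>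
      tsum_scaledBetaMoment_rpow_mono (by linarith) (by linarith) m x

/-! ### Comparison with `α = 0` -/

theorem isMomentSeq_betaMoment (m : ℕ) : IsMomentSeq 1 (betaMoment m) := by
  simpa using isMomentSeq_betaMoment_rpow zero_le_one m

theorem tsum_betaMoment_eq (m : ℕ) (y : ℝ) :
    ∑' n, y ^ n / n ! * betaMoment m n =
      1 + y / (m + 1) * ∑' n, y ^ n / n ! * betaMoment (m + 1) n := by
  rw [((isMomentSeq_betaMoment m).summable y).tsum_eq_zero_add, ← tsum_mul_left]
  congr 1
  · simpa [scaledBetaMoment] using scaledBetaMoment_zero m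
  · refine tsum_congr fun n => ?_
    rw [betaMoment_succ_left, betaMoment_succ_right, Nat.factorial_succ]
    push_cast
    have : (0 : ℝ) < n ! := by positivity
    field_simp
    ring

/-- Let `S m` be the series of beta moments at `y = x (m + 1)`. Then `S m = 1 + x S (m + 1)`, with
the same `y` on both sides. As `y ≤ 0`, an extra factor in `[0, 1]` gives `S m ≤ S (m + 1)`; as `x ≤
0`, this yields `S m ≤ 1 + x S m`. -/
theorem tsum_scaledBetaMoment_le {x : ℝ} (hx : x ≤ 0) (m : ℕ) :
    ∑' n, x ^ n / n ! * scaledBetaMoment m n ≤ 1 / (1 - x) := by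
  have hm : (0 : ℝ) < m + 1 := by positivity
  have hy : x * (m + 1) ≤ 0 := mul_nonpos_of_nonpos_of_nonneg hx hm.le
  have e : ∑' n, x ^ n / n ! * scaledBetaMoment m n =
      ∑' n, (x * (m + 1)) ^ n / n ! * betaMoment m n :=
    tsum_congr fun n => by rw [scaledBetaMoment, mul_pow]; ring
  have h1 := tsum_betaMoment_eq m (x * (m + 1))
  have h2 : ∑' n, (x * (m + 1)) ^ n / n ! * betaMoment m n ≤
      ∑' n, (x * (m + 1)) ^ n / n ! * betaMoment (m + 1) n := by
    have hd := IsMomentSeq.gamma zero_le_one hm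
    simp only [Real.rpow_one] at hd
    simpa only [betaMoment_succ_left] using
      (isMomentSeq_betaMoment m).tsum_le_tsum_mul_of_nonpos hd hy
  rw [mul_div_cancel_right₀ _ hm.ne'] at h1
  rw [e, le_div_iff₀ (by linarith)]
  linarith [mul_le_mul_of_nonpos_left h2 hx]

theorem tsum_leRoy_le_one_div {β x : ℝ} (h0 : 0 < β) (h1 : β ≤ 1) (hx : x < 1) :
    ∑' n : ℕ, x ^ n / (n ! : ℝ) ^ β ≤ 1 / (1 - x) := by
  -- For `x ≥ 0` the geometric series dominates termwise. For `x ≤ 0` the comparison is with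
  -- exponent `t = 1` before the limit, so no convergence at `α = 0` is needed.
  rcases le_total 0 x with h | h
  · rw [one_div, ← tsum_geometric_of_lt_one h hx]
    refine (summable_leRoy h0 x).tsum_le_tsum (fun n => ?_) (summable_geometric_of_lt_one h hx)
    exact div_le_self (by positivity)
      (Real.one_le_rpow (by exact_mod_cast n.factorial_pos) h0.le)
  · refine le_of_tendsto' (tendsto_tsum_scaledBetaMoment h0 h1 x) fun m => ?_
    refine (tsum_scaledBetaMoment_rpow_mono (t := 1) (by linarith) (by linarith) m x).trans ?_
    simpa using tsum_scaledBetaMoment_le h m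

theorem proposition4p26 (x : ℝ) :
    AntitoneOn (fun α : ℝ => leRoy α x) (Set.Icc (0 : ℝ) 1) := by
  rintro α ⟨hα, -⟩ β ⟨-, hβ⟩ hαβ
  rcases hα.eq_or_lt with rfl | hα
  · rcases hαβ.eq_or_lt with rfl | h
    · exact le_rfl
    · simp only [leRoy, if_neg h.ne', if_true]
      split_ifs with hx
      · exact EReal.coe_le_coe_iff.2 (tsum_leRoy_le_one_div h hβ hx)
      · exact le_top
  · simp only [leRoy, if_neg hα.ne', if_neg (hα.trans_le hαβ).ne']
    exact EReal.coe_le_coe_iff.2 (tsum_leRoy_antitone hα hαβ hβ x)
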